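/- There is an absolute constant $c>0$ such that the following holds for every finite field $\mathbb F_q$. Let $\chi:\mathbb F_q\to\mathbb C$ satisfy $\chi(xy)=\chi(x)\chi(y)$ for all $x,y\in\mathbb F_q$, and suppose that $\chi$ is nontrivial, i.e. $\chi(x)\neq 1$ for some $x\neq 0$. Let $g$ be a generator of $\mathbb F_q^\times$ and let $d\ge 1$ be an integer with $\chi(g^d)=1$. Define $f:\mathbb F_q\times\mathbb F_q\to\mathbb C$ by $f(x,y)=\chi(x+y)$. Then \[ \mathrm{Qcc}(f)\;\ge\; c\cdot\frac{\log q}{\log(d+1)} . \] Here $\mathrm{Qcc}(f)$ is the entanglement-assisted two-way quantum communication complexity of $f$ with error $1/3$: the minimum total number of qubits exchanged (in both directions) in a protocol in which Alice is given $x$, Bob is given $y$, they share an initial entangled pure state of arbitrary finite dimension that does not depend on the inputs, they alternate between applying local unitaries (each depending only on the acting party's input) and sending single qubits to each other, in an order that does not depend on the inputs, and finally Bob measures his register and outputs a value that, for every pair $(x,y)$, equals $f(x,y)$ with probability at least $2/3$. -/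

import Mathlib

/-!
Two-party quantum communication protocols with shared entanglement.

Alice's register has basis `Fin a` and Bob's register has basis `Fin b`.  A joint pure state is the
matrix of its amplitudes, `ψ i j` being the amplitude of `|i⟩ ⊗ |j⟩`.  A unitary `U` of Alice acts
as `ψ ↦ U * ψ`, a unitary `V` of Bob acts as `ψ ↦ ψ * Vᵀ`.
-/

namespace QComm

/-- The amplitudes of a joint pure state of a register of dimension `a` held by Alice and a
register of dimension `b` held by Bob. -/
abbrev State (a b : ℕ) : Type := Matrix (Fin a) (Fin b) ℂ

/-- The change of registers when the last qubit of Alice's register is handed over to Bob: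
`(ℂ^a ⊗ ℂ^2) ⊗ ℂ^b` becomes `ℂ^a ⊗ (ℂ^b ⊗ ℂ^2)`. -/
def sendToBob {a b : ℕ} (ψ : State (a * 2) b) : State a (b * 2) :=
  fun i j => ψ (finProdFinEquiv (i, (finProdFinEquiv.symm j).2)) (finProdFinEquiv.symm j).1

/-- The change of registers when the last qubit of Bob's register is handed over to Alice. -/
def sendToAlice {a b : ℕ} (ψ : State a (b * 2)) : State (a * 2) b :=
  fun i j => ψ (finProdFinEquiv.symm i).1 (finProdFinEquiv (j, (finProdFinEquiv.symm i).2))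

/-- A two-way qubit protocol without intermediate measurements, for an input `x : X` of Alice and
an input `y : Y` of Bob, at a moment at which Alice holds a register of dimension `a` and Bob a
register of dimension `b`.  Ancillas are part of these registers from the start.
Who sends at which moment does not depend on the inputs. -/
inductive Protocol (X Y Z : Type*) : ℕ → ℕ → Type _
  /-- No more communication: Bob applies a unitary that depends on his input, measures his register
  in the standard basis, and outputs a value computed from the result and his input. -/
  | output {a b : ℕ} (V : Y → Matrix.unitaryGroup (Fin b) ℂ) (out : Y → Fin b → Z) :
      Protocol X Y Z a b
  /-- Alice applies to her register a unitary that depends on her input and then sends the last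
  qubit of her register to Bob. -/
  | aliceSends {a b : ℕ} (U : X → Matrix.unitaryGroup (Fin (a * 2)) ℂ)
      (rest : Protocol X Y Z a (b * 2)) : Protocol X Y Z (a * 2) b
  /-- Bob applies to his register a unitary that depends on his input and then sends the last qubit
  of his register to Alice. -/
  | bobSends {a b : ℕ} (V : Y → Matrix.unitaryGroup (Fin (b * 2)) ℂ)
      (rest : Protocol X Y Z (a * 2) b) : Protocol X Y Z a (b * 2)

namespace Protocol

variable {X Y Z : Type*}

/-- The total number of qubits exchanged, in both directions together. -/
def cost : {a b : ℕ} → Protocol X Y Z a b → ℕ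
  | _, _, output _ _ => 0
  | _, _, aliceSends _ rest => rest.cost + 1
  | _, _, bobSends _ rest => rest.cost + 1

open Classical in
/-- The probability that Bob outputs `z` when the remaining protocol is run on the inputs `x`, `y`
from the joint state `ψ`. -/
noncomputable def outputProb (x : X) (y : Y) (z : Z) :
    {a b : ℕ} → Protocol X Y Z a b → State a b → ℝ
  | _, b, output V out, ψ =>
      ∑ j : Fin b, if out y j = z then ∑ i, ‖(ψ * (V y).val.transpose) i j‖ ^ 2 else 0
  | _, _, aliceSends U rest, ψ => rest.outputProb x y z (sendToBob ((U x).val * ψ))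
  | _, _, bobSends V rest, ψ => rest.outputProb x y z (sendToAlice (ψ * (V y).val.transpose))

end Protocol

/-- Some protocol that exchanges exactly `n` qubits and starts from a shared state (a unit vector
of arbitrary finite dimension, independent of the inputs) makes Bob output `f x y` with failure
probability at most `ε`, for all inputs `x`, `y`. -/
def IsComputableWith {X Y Z : Type*} (ε : ℝ) (f : X → Y → Z) (n : ℕ) : Prop :=
  ∃ (a b : ℕ) (φ : State a b) (P : Protocol X Y Z a b),
    ∑ i, ∑ j, ‖φ i j‖ ^ 2 = 1 ∧ P.cost = n ∧ ∀ x y, 1 - ε ≤ P.outputProb x y (f x y) φ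

/-- The entanglement-assisted two-way qubit communication complexity with error `ε`: the minimum
number of qubits exchanged in a protocol for `f` with failure probability at most `ε`.  For finite
`X`, nonempty `Z` and `0 ≤ ε` the minimum exists, see `exists_isComputableWith`. -/
noncomputable def QccErr {X Y Z : Type*} (ε : ℝ) (f : X → Y → Z) : ℕ :=
  sInf {n | IsComputableWith ε f n}

/-- The bounded-error complexity: failure probability at most `1/3`. -/
noncomputable def Qcc {X Y Z : Type*} (f : X → Y → Z) : ℕ := QccErr (1 / 3) f

theorem sendToBob_single {a b : ℕ} (i : Fin (a * 2)) (j : Fin b) :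
    sendToBob (Matrix.single i j 1) = Matrix.single (finProdFinEquiv.symm i).1
      (finProdFinEquiv (j, (finProdFinEquiv.symm i).2)) 1 := by
  obtain ⟨⟨i, c⟩, rfl⟩ := finProdFinEquiv.surjective i
  ext k l
  obtain ⟨⟨l, d⟩, rfl⟩ := finProdFinEquiv.surjective l
  simp only [sendToBob, Matrix.single_apply, Equiv.symm_apply_apply, EmbeddingLike.apply_eq_iff_eq,
    Prod.mk.injEq]
  congr 1
  simp only [eq_iff_iff]
  tauto

theorem exists_unitary_single {n : ℕ} (i₀ i : Fin n) :
    ∃ U ∈ Matrix.unitaryGroup (Fin n) ℂ, ∀ (m : ℕ) (j : Fin m),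
      U * Matrix.single i₀ j (1 : ℂ) = Matrix.single i j 1 := by
  refine ⟨(Equiv.swap i₀ i).permMatrix ℂ, ?_, fun m j => ?_⟩
  · rw [Matrix.mem_unitaryGroup_iff, Matrix.star_eq_conjTranspose, Matrix.conjTranspose_permMatrix,
      ← Matrix.permMatrix_mul]
    simp
  · ext k l
    rw [Equiv.Perm.permMatrix, PEquiv.toMatrix_toPEquiv_mul]
    simp only [Matrix.single_apply, Matrix.submatrix_apply, id]
    congr 1
    have h : i₀ = Equiv.swap i₀ i k ↔ i = k := by
      rw [← Equiv.swap_apply_eq_iff, Equiv.swap_apply_left]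
    rw [h]

theorem exists_protocol_of_basis {X Y Z : Type*} [Nonempty Z] (f : X → Y → Z) (k : ℕ) :
    ∀ (b : ℕ) (i₀ i : X → Fin (2 ^ k)) (j : X → Fin b)
      (_ : ∀ x x', i x = i x' → j x = j x' → x = x'),
      ∃ P : Protocol X Y Z (2 ^ k) b, ∀ x y,
        P.outputProb x y (f x y) (Matrix.single (i₀ x) (j x) 1) = 1 := by
  classical
  induction k with
  | zero =>
    intro b i₀ i j h
    refine ⟨.output (fun _ => 1) (fun y l => if hl : ∃ x, j x = l then f hl.choose y
      else Classical.arbitrary Z), fun x y => ?_⟩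
    have hc : ∃ x', j x' = j x := ⟨x, rfl⟩
    have hx : hc.choose = x := h _ _ (Subsingleton.elim (α := Fin 1) _ _) hc.choose_spec
    simp only [Protocol.outputProb, OneMemClass.coe_one, Matrix.transpose_one, Matrix.mul_one]
    rw [Finset.sum_eq_single (j x)]
    · rw [dif_pos hc, hx, if_pos rfl, Finset.sum_eq_single (i₀ x)]
      · rw [Matrix.single_apply_same]; norm_num
      · intro l _ hl
        rw [Matrix.single_apply_of_row_ne hl.symm]; norm_num
      · exact fun h => (h (Finset.mem_univ _)).elim
    · intro l _ hl
      simp [hl.symm]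
    · simp
  | succ k ih =>
    intro b i₀ i j h
    choose U hU hU' using fun x => exists_unitary_single (i₀ x) (i x)
    let e : Fin (2 ^ k) × Fin 2 ≃ Fin (2 ^ k * 2) := finProdFinEquiv
    let e' : Fin b × Fin 2 ≃ Fin (b * 2) := finProdFinEquiv
    obtain ⟨P, hP⟩ := ih (b * 2) (fun x => (e.symm (i x)).1) (fun x => (e.symm (i x)).1)
      (fun x => e' (j x, (e.symm (i x)).2)) (fun x x' h1 h2 => by
        obtain ⟨h3, h4⟩ := Prod.mk.inj (e'.injective h2)
        exact h x x' (e.symm.injective (Prod.ext h1 h4)) h3)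
    refine ⟨.aliceSends (fun x => ⟨U x, hU x⟩) P, fun x y => ?_⟩
    rw [← hP x y]
    refine Eq.trans ?_ (congrArg (P.outputProb x y (f x y))
      (sendToBob_single (a := 2 ^ k) (i x) (j x)))
    exact congrArg (fun ψ => P.outputProb x y (f x y) (sendToBob (a := 2 ^ k) ψ)) (hU' x b (j x))

/-- The minimum in the definition of `QccErr` is over a nonempty set. -/
theorem exists_isComputableWith {X Y Z : Type*} [Finite X] [Nonempty Z] {ε : ℝ} (hε : 0 ≤ ε)
    (f : X → Y → Z) : ∃ n, IsComputableWith ε f n := by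
  obtain ⟨m, ⟨e⟩⟩ := Finite.exists_equiv_fin X
  obtain ⟨P, hP⟩ := exists_protocol_of_basis f m 1 (fun _ => ⟨0, by positivity⟩)
    (fun x => (e x).castLE Nat.lt_two_pow_self.le) (fun _ => 0)
    (fun x x' h _ => e.injective (Fin.castLE_injective _ h))
  refine ⟨P.cost, 2 ^ m, 1, Matrix.single ⟨0, by positivity⟩ 0 1, P, ?_, rfl, fun x y => ?_⟩
  · rw [Finset.sum_eq_single (⟨0, by positivity⟩ : Fin (2 ^ m))]
    · rw [Fin.sum_univ_one, Matrix.single_apply_same]; norm_num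
    · intro l _ hl
      refine Finset.sum_eq_zero fun r _ => ?_
      rw [Matrix.single_apply_of_row_ne hl.symm]; norm_num
    · simp
  · rw [hP x y]
    linarith

end QComm

/-! With n qubits exchanged, the mean of Bob's output is a sum of `4 ^ n` terms `tr (M x * φ * N y *
φᴴ)` with contractions `M x`, `N y` (`hasContractionForm_sum_mul_outputProb`). However large the
shared entanglement, each term is an inner product of vectors of norm at most 1
(`exists_trace_eq_inner`).

The matrix `χ (x + y)` correlates weakly with such matrices: its rows are nearly orthogonal, so the
correlation is at most `q * √q` (`norm_sum_star_mulChar_mul_inner_le`). A correct protocol has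
correlation at least `q * (q - 1) / 3`, because each unimodular target is hit with probability at
least `2/3` (`one_third_le_re_star_mul_sum`). Hence `q - 1 ≤ 3 * 4 ^ n * √q`, and n is at least a
constant times `log q`. This implies the claim because `log (d + 1) ≥ log 2`. -/

namespace QComm

open scoped Matrix.Norms.L2Operator Matrix

/-! ### Protocols as sums of contraction forms -/

section ContractionForms

variable {X Y Z : Type*}

theorem norm_one_matrix_le {n : ℕ} : ‖(1 : Matrix (Fin n) (Fin n) ℂ)‖ ≤ 1 := by
  rw [← Matrix.diagonal_one, Matrix.l2_opNorm_diagonal, pi_norm_le_iff_of_nonneg zero_le_one]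
  simp

theorem norm_le_one_of_conjTranspose_mul_self {m n : ℕ} {A : Matrix (Fin m) (Fin n) ℂ}
    (h : Aᴴ * A = 1) : ‖A‖ ≤ 1 := by
  have h1 := Matrix.l2_opNorm_conjTranspose_mul_self A
  rw [h] at h1
  nlinarith [norm_one_matrix_le (n := n), norm_nonneg A]

theorem norm_unitary_le_one {n : ℕ} (U : Matrix.unitaryGroup (Fin n) ℂ) : ‖U.val‖ ≤ 1 :=
  norm_le_one_of_conjTranspose_mul_self (Matrix.mem_unitaryGroup_iff'.1 U.2)

theorem norm_unitary_transpose_le_one {n : ℕ} (U : Matrix.unitaryGroup (Fin n) ℂ) :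
    ‖U.valᵀ‖ ≤ 1 := by
  refine norm_le_one_of_conjTranspose_mul_self ?_
  have h := congrArg Matrix.transpose (Matrix.mem_unitaryGroup_iff.1 U.2)
  rwa [Matrix.transpose_mul, Matrix.transpose_one] at h

theorem norm_mul_le_one {l m n : ℕ} {A : Matrix (Fin l) (Fin m) ℂ} {B : Matrix (Fin m) (Fin n) ℂ}
    (hA : ‖A‖ ≤ 1) (hB : ‖B‖ ≤ 1) : ‖A * B‖ ≤ 1 :=
  (Matrix.l2_opNorm_mul A B).trans (mul_le_one₀ hA (norm_nonneg _) hB)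

theorem norm_conjTranspose_le_one {m n : ℕ} {A : Matrix (Fin m) (Fin n) ℂ}
    (hA : ‖A‖ ≤ 1) : ‖Aᴴ‖ ≤ 1 := by
  rwa [Matrix.l2_opNorm_conjTranspose]

/-- Multiplication by a contraction does not increase the Frobenius norm. -/
theorem sum_norm_sq_mul_le {l m n : ℕ} {A : Matrix (Fin l) (Fin m) ℂ} (hA : ‖A‖ ≤ 1)
    (B : Matrix (Fin m) (Fin n) ℂ) :
    ∑ i, ∑ j, ‖(A * B) i j‖ ^ 2 ≤ ∑ i, ∑ j, ‖B i j‖ ^ 2 := by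
  rw [Finset.sum_comm, Finset.sum_comm (s := Finset.univ (α := Fin m))]
  refine Finset.sum_le_sum fun j _ => ?_
  have h := (Matrix.l2_opNorm_mulVec A (WithLp.toLp 2 fun i => B i j)).trans
    (mul_le_of_le_one_left (norm_nonneg _) hA)
  have h2 := pow_le_pow_left₀ (norm_nonneg _) h 2
  rw [EuclideanSpace.norm_sq_eq, EuclideanSpace.norm_sq_eq] at h2
  exact h2

/-- The projection of a register onto the subspace where its last qubit is `|c⟩`. -/
def qubitSlice (a : ℕ) (c : Fin 2) : Matrix (Fin a) (Fin (a * 2)) ℂ :=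
  fun i k => if k = finProdFinEquiv (i, c) then 1 else 0

theorem norm_qubitSlice_le_one (a : ℕ) (c : Fin 2) : ‖qubitSlice a c‖ ≤ 1 := by
  rw [← Matrix.l2_opNorm_conjTranspose]
  refine norm_le_one_of_conjTranspose_mul_self ?_
  ext i j
  rw [Matrix.conjTranspose_conjTranspose, Matrix.mul_apply, Matrix.one_apply]
  simp only [qubitSlice, Matrix.conjTranspose_apply, ite_mul, one_mul, zero_mul,
    Finset.sum_ite_eq', Finset.mem_univ, if_true]
  simp

theorem sendToBob_eq_sum {a b : ℕ} (ψ : State (a * 2) b) :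
    sendToBob ψ = ∑ c, qubitSlice a c * ψ * qubitSlice b c := by
  ext i j
  obtain ⟨⟨j, d⟩, rfl⟩ := finProdFinEquiv.surjective j
  rw [Matrix.sum_apply]
  simp [sendToBob, qubitSlice, Matrix.mul_apply, ite_and]

theorem sendToAlice_eq_sum {a b : ℕ} (ψ : State a (b * 2)) :
    sendToAlice ψ = ∑ c, (qubitSlice a c)ᴴ * ψ * (qubitSlice b c)ᴴ := by
  ext i j
  obtain ⟨⟨i, d⟩, rfl⟩ := finProdFinEquiv.surjective i
  rw [Matrix.sum_apply]
  simp [sendToAlice, qubitSlice, Matrix.mul_apply, ite_and, apply_ite]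

/-- `E x y` is a sum of `4 ^ n` quadratic forms `ψ ↦ tr (M x * ψ * N y * ψᴴ)` in which `M x` and
`N y` are contractions. -/
def HasContractionForm {a b : ℕ} (n : ℕ) (E : X → Y → State a b → ℂ) : Prop :=
  ∃ (ι : Type) (_ : Fintype ι) (M : ι → X → Matrix (Fin a) (Fin a) ℂ)
    (N : ι → Y → Matrix (Fin b) (Fin b) ℂ),
    Fintype.card ι = 4 ^ n ∧ (∀ s x, ‖M s x‖ ≤ 1) ∧ (∀ s y, ‖N s y‖ ≤ 1) ∧
      ∀ x y ψ, E x y ψ = ∑ s, (M s x * ψ * N s y * ψᴴ).trace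

/-- One qubit of communication turns the state into a sum of two terms `K c x * ψ * L c y`.
Expanding both occurrences of the state in a quadratic form gives four forms indexed by pairs `(c,
d)`; cyclicity of the trace brings the adjoint of `K d x` to Alice's side. -/
theorem HasContractionForm.comp {a b a' b' n : ℕ} {E : X → Y → State a' b' → ℂ}
    (hE : HasContractionForm n E) (K : Fin 2 → X → Matrix (Fin a') (Fin a) ℂ)
    (L : Fin 2 → Y → Matrix (Fin b) (Fin b') ℂ) (hK : ∀ c x, ‖K c x‖ ≤ 1)
    (hL : ∀ c y, ‖L c y‖ ≤ 1) :
    HasContractionForm (n + 1) fun x y (ψ : State a b) =>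
      E x y (∑ c, (K c x * ψ * L c y : Matrix (Fin a') (Fin b') ℂ)) := by
  obtain ⟨ι, _, M, N, hι, hM, hN, h⟩ := hE
  refine ⟨ι × Fin 2 × Fin 2, inferInstance, fun s x => (K s.2.2 x)ᴴ * (M s.1 x * K s.2.1 x),
    fun s y => L s.2.1 y * (N s.1 y * (L s.2.2 y)ᴴ), ?_, fun s x => ?_, fun s y => ?_,
    fun x y ψ => ?_⟩
  · simp [hι, pow_succ]
  · exact norm_mul_le_one (norm_conjTranspose_le_one (hK _ _)) (norm_mul_le_one (hM _ _) (hK _ _))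
  · exact norm_mul_le_one (hL _ _) (norm_mul_le_one (hN _ _) (norm_conjTranspose_le_one (hL _ _)))
  · simp only [h, Fintype.sum_prod_type]
    refine Finset.sum_congr rfl fun s _ => ?_
    simp only [Matrix.conjTranspose_sum, Matrix.mul_sum, Matrix.sum_mul, Matrix.trace_sum]
    rw [Finset.sum_comm]
    refine Finset.sum_congr rfl fun c _ => Finset.sum_congr rfl fun d _ => ?_
    simp only [Matrix.conjTranspose_mul, Matrix.mul_assoc]
    rw [Matrix.trace_mul_comm (K d x)ᴴ]
    simp only [Matrix.mul_assoc]

theorem sum_mul_outputProb_output {a b : ℕ} (S : Finset Z) (w : Z → ℂ)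
    (V : Y → Matrix.unitaryGroup (Fin b) ℂ) (out : Y → Fin b → Z) (x : X) (y : Y)
    (ψ : State a b) :
    ∑ z ∈ S, w z * ((Protocol.output V out : Protocol X Y Z a b).outputProb x y z ψ : ℂ) =
      ∑ j, (open Classical in if out y j ∈ S then w (out y j) else 0) *
        ((∑ i, ‖(ψ * (V y).valᵀ) i j‖ ^ 2 : ℝ) : ℂ) := by
  classical
  simp only [Protocol.outputProb]
  simp_rw [Complex.ofReal_sum (s := Finset.univ (α := Fin b)), Finset.mul_sum]
  rw [Finset.sum_comm]
  refine Finset.sum_congr rfl fun j _ => ?_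
  simp_rw [apply_ite Complex.ofReal, Complex.ofReal_zero, mul_ite, mul_zero, ite_mul, zero_mul]
  rw [Finset.sum_ite_eq, Complex.ofReal_sum, Finset.mul_sum]

theorem hasContractionForm_sum_mul_outputProb (S : Finset Z) {w : Z → ℂ} (hw : ∀ z ∈ S, ‖w z‖ ≤ 1)
    {a b : ℕ} (P : Protocol X Y Z a b) :
    HasContractionForm P.cost fun x y ψ => ∑ z ∈ S, w z * (P.outputProb x y z ψ : ℂ) := by
  classical
  induction P with
  | @output a b V out =>
    -- The measurement is a diagonal matrix of output weights conjugated by Bob's unitary; outputs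
    -- outside `S` get weight 0.
    refine ⟨Unit, inferInstance, fun _ _ => 1, fun _ y => (V y).valᵀ *
      (Matrix.diagonal (fun j => if out y j ∈ S then w (out y j) else 0) * ((V y).valᵀ)ᴴ),
      rfl, fun _ _ => norm_one_matrix_le, fun _ y => ?_, fun x y ψ => ?_⟩
    · refine norm_mul_le_one (norm_unitary_transpose_le_one _) (norm_mul_le_one ?_
        (norm_conjTranspose_le_one (norm_unitary_transpose_le_one _)))
      rw [Matrix.l2_opNorm_diagonal, pi_norm_le_iff_of_nonneg zero_le_one]
      intro j
      split_ifs with h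
      · exact hw _ h
      · simp
    · refine (sum_mul_outputProb_output S w V out x y ψ).trans ?_
      simp only [Finset.univ_unique, Finset.sum_singleton, Matrix.one_mul]
      rw [← Matrix.mul_assoc, ← Matrix.mul_assoc, Matrix.mul_assoc _ _ ψᴴ,
        ← Matrix.conjTranspose_mul, Matrix.mul_assoc, Matrix.trace_mul_comm, Matrix.mul_assoc,
        Matrix.trace]
      refine Finset.sum_congr rfl fun j _ => ?_
      rw [Matrix.diag_apply, Matrix.diagonal_mul, Matrix.mul_apply]
      congr 1
      rw [Complex.ofReal_sum]
      refine Finset.sum_congr rfl fun i _ => ?_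
      rw [Matrix.conjTranspose_apply, Complex.ofReal_pow, ← Complex.conj_mul']
      rfl
  | @aliceSends a b U rest ih =>
    have := ih.comp (fun c x => qubitSlice a c * (U x).val) (fun c _ => qubitSlice b c)
      (fun c x => norm_mul_le_one (norm_qubitSlice_le_one a c) (norm_unitary_le_one _))
      (fun c _ => norm_qubitSlice_le_one b c)
    simpa only [Protocol.cost, Protocol.outputProb, sendToBob_eq_sum, Matrix.mul_assoc] using this
  | @bobSends a b V rest ih =>
    have := ih.comp (fun c _ => (qubitSlice a c)ᴴ) (fun c y => (V y).valᵀ * (qubitSlice b c)ᴴ)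
      (fun c _ => norm_conjTranspose_le_one (norm_qubitSlice_le_one a c))
      (fun c y => norm_mul_le_one (norm_unitary_transpose_le_one _)
        (norm_conjTranspose_le_one (norm_qubitSlice_le_one b c)))
    simpa only [Protocol.cost, Protocol.outputProb, sendToAlice_eq_sum, Matrix.mul_assoc] using this

theorem sum_norm_sq_mul_transpose_le {l m : ℕ} (V : Matrix.unitaryGroup (Fin m) ℂ)
    (B : Matrix (Fin l) (Fin m) ℂ) :
    ∑ i, ∑ j, ‖(B * V.valᵀ) i j‖ ^ 2 ≤ ∑ i, ∑ j, ‖B i j‖ ^ 2 := by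
  have h := sum_norm_sq_mul_le (norm_unitary_le_one V) Bᵀ
  rw [Finset.sum_comm, Finset.sum_comm (s := Finset.univ (α := Fin l))]
  rwa [show V.val * Bᵀ = (B * V.valᵀ)ᵀ by simp [Matrix.transpose_mul]] at h

theorem sum_norm_sq_sendToBob {a b : ℕ} (ψ : State (a * 2) b) :
    ∑ i, ∑ j, ‖sendToBob ψ i j‖ ^ 2 = ∑ i, ∑ j, ‖ψ i j‖ ^ 2 := by
  rw [← finProdFinEquiv.sum_comp, Fintype.sum_prod_type]
  refine Finset.sum_congr rfl fun i _ => ?_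
  rw [← finProdFinEquiv.sum_comp, Fintype.sum_prod_type, Finset.sum_comm]
  simp [sendToBob]

theorem sum_norm_sq_sendToAlice {a b : ℕ} (ψ : State a (b * 2)) :
    ∑ i, ∑ j, ‖sendToAlice ψ i j‖ ^ 2 = ∑ i, ∑ j, ‖ψ i j‖ ^ 2 := by
  rw [← finProdFinEquiv.sum_comp, Fintype.sum_prod_type]
  refine Finset.sum_congr rfl fun i _ => ?_
  rw [← finProdFinEquiv.sum_comp, Fintype.sum_prod_type, Finset.sum_comm]
  simp [sendToAlice]

namespace Protocol

theorem outputProb_nonneg {a b : ℕ} (P : Protocol X Y Z a b) (x : X) (y : Y) (z : Z)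
    (ψ : State a b) : 0 ≤ P.outputProb x y z ψ := by
  induction P with
  | output V out =>
    refine Finset.sum_nonneg fun j _ => ?_
    split_ifs
    · positivity
    · exact le_rfl
  | aliceSends U rest ih => exact ih _
  | bobSends V rest ih => exact ih _

theorem sum_outputProb_le {a b : ℕ} (P : Protocol X Y Z a b) (S : Finset Z) (x : X) (y : Y)
    (ψ : State a b) : ∑ z ∈ S, P.outputProb x y z ψ ≤ ∑ i, ∑ j, ‖ψ i j‖ ^ 2 := by
  classical
  induction P with
  | output V out =>
    refine le_trans ?_ (sum_norm_sq_mul_transpose_le (V y) ψ)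
    simp only [outputProb]
    rw [Finset.sum_comm, Finset.sum_comm (f := fun i j => ‖(ψ * (V y).valᵀ) i j‖ ^ 2)]
    refine Finset.sum_le_sum fun j _ => ?_
    rw [Finset.sum_ite_eq]
    split_ifs
    · exact le_rfl
    · positivity
  | aliceSends U rest ih =>
    refine (ih _).trans ?_
    rw [sum_norm_sq_sendToBob]
    exact sum_norm_sq_mul_le (norm_unitary_le_one _) _
  | bobSends V rest ih =>
    refine (ih _).trans ?_
    rw [sum_norm_sq_sendToAlice]
    exact sum_norm_sq_mul_transpose_le _ _

/-- Without communication Bob learns nothing about Alice's input. -/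
theorem outputProb_eq_of_cost_eq_zero {a b : ℕ} (P : Protocol X Y Z a b) (h : P.cost = 0)
    (x x' : X) (y : Y) (z : Z) (ψ : State a b) :
    P.outputProb x y z ψ = P.outputProb x' y z ψ := by
  cases P with
  | output V out => rfl
  | aliceSends U rest => simp [cost] at h
  | bobSends V rest => simp [cost] at h

end Protocol

/-- The traces in a contraction form are inner products of short vectors. -/
theorem exists_trace_eq_inner {a b : ℕ} {φ : State a b} (hφ : ∑ i, ∑ j, ‖φ i j‖ ^ 2 = 1)
    {M : X → Matrix (Fin a) (Fin a) ℂ} {N : Y → Matrix (Fin b) (Fin b) ℂ}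
    (hM : ∀ x, ‖M x‖ ≤ 1) (hN : ∀ y, ‖N y‖ ≤ 1) :
    ∃ (u : X → EuclideanSpace ℂ (Fin a × Fin b)) (v : Y → EuclideanSpace ℂ (Fin a × Fin b)),
      (∀ x, ‖u x‖ ≤ 1) ∧ (∀ y, ‖v y‖ ≤ 1) ∧
        ∀ x y, (M x * φ * N y * φᴴ).trace = inner ℂ (v y) (u x) := by
  -- The two factors `M x * φ` and `N y * φᴴ`, flattened to vectors; the conjugation cancels that in
  -- the first slot of `inner`.
  refine ⟨fun x => WithLp.toLp 2 fun p => (M x * φ) p.1 p.2,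
    fun y => WithLp.toLp 2 fun p => star ((N y * φᴴ) p.2 p.1), fun x => ?_, fun y => ?_,
    fun x y => ?_⟩
  · rw [← sq_le_one_iff₀ (norm_nonneg _), EuclideanSpace.norm_sq_eq, Fintype.sum_prod_type, ← hφ]
    exact sum_norm_sq_mul_le (hM x) φ
  · rw [← sq_le_one_iff₀ (norm_nonneg _), EuclideanSpace.norm_sq_eq, Fintype.sum_prod_type, ← hφ]
    have h := sum_norm_sq_mul_le (hN y) φᴴ
    rw [Finset.sum_comm, Finset.sum_comm (f := fun i j => ‖φᴴ i j‖ ^ 2)] at h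
    simpa only [Matrix.conjTranspose_apply, norm_star] using h
  · rw [Matrix.mul_assoc, Matrix.trace, PiLp.inner_apply, Fintype.sum_prod_type]
    refine Finset.sum_congr rfl fun i _ => ?_
    rw [Matrix.diag_apply, Matrix.mul_apply]
    simp

end ContractionForms

/-! ### Near-orthogonality of shifted characters -/

section Characters

variable {F : Type*} [Field F] [Fintype F]

/-- The rows of the matrix `χ (x + y)` are nearly orthogonal. -/
theorem sum_mulChar_add_mul_star [DecidableEq F] {χ : MulChar F ℂ} (hχ : χ ≠ 1) (x x' : F) :
    ∑ y, χ (x + y) * star (χ (x' + y)) = (if x = x' then (Fintype.card F : ℂ) else 0) - 1 := by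
  have hinv : ∀ y, star (χ y) = χ⁻¹ y := fun y => MulChar.star_apply' χ y
  have hs : ∑ y, χ (x + y) * star (χ (x' + y)) = ∑ y, χ (y + (x - x')) * star (χ y) := by
    rw [← Equiv.sum_comp (Equiv.addLeft x') (fun y => χ (y + (x - x')) * star (χ y))]
    refine Finset.sum_congr rfl fun y _ => ?_
    rw [Equiv.coe_addLeft]
    congr 2
    ring
  rw [hs, ← Finset.sum_erase_add _ _ (Finset.mem_univ (0 : F)), MulChar.map_zero χ, star_zero,
    mul_zero, add_zero]
  -- Since `star (χ y) = χ y⁻¹`, the two factors merge into one value of `χ`.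
  have hy : ∀ y ∈ Finset.univ.erase (0 : F),
      χ (y + (x - x')) * star (χ y) = χ (1 + (x - x') * y⁻¹) := by
    intro y hy
    have hy0 := Finset.ne_of_mem_erase hy
    rw [hinv, MulChar.inv_apply', ← map_mul]
    congr 1
    field_simp
  rw [Finset.sum_congr rfl hy]
  split_ifs with h
  · subst h
    simp [Finset.card_erase_of_mem, Nat.cast_sub Fintype.card_pos]
  · have ht : x - x' ≠ 0 := sub_ne_zero.2 h
    have hz := MulChar.sum_eq_zero_of_ne_one hχ
    rw [← Finset.sum_erase_add _ _ (Finset.mem_univ (1 : F)), map_one] at hz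
    rw [zero_sub, ← eq_neg_of_add_eq_zero_left hz]
    -- For `x ≠ x'` this argument runs once through every element except 1, so the sum is `0 - χ 1 =
    -- -1`.
    refine Finset.sum_bij' (fun y _ => 1 + (x - x') * y⁻¹) (fun z _ => (x - x') / (z - 1))
      ?_ ?_ ?_ ?_ ?_
    · intro y hy
      have hy0 := Finset.ne_of_mem_erase hy
      simp [ht, hy0]
    · intro z hz
      have := sub_ne_zero.2 (Finset.ne_of_mem_erase hz)
      simp [ht, this]
    · intro y hy
      have hy0 := Finset.ne_of_mem_erase hy
      simp only [add_sub_cancel_left]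
      field_simp
    · intro z hz
      have := sub_ne_zero.2 (Finset.ne_of_mem_erase hz)
      field_simp
      ring
    · intro y _
      rfl

variable {E : Type*} [NormedAddCommGroup E] [InnerProductSpace ℂ E]

/-- The Gram matrix of the rows is `q * I - J`, with `J` the all-ones matrix. -/
theorem sum_norm_sq_sum_star_mulChar_smul {χ : MulChar F ℂ} (hχ : χ ≠ 1) (u : F → E) :
    ∑ y, ‖∑ x, star (χ (x + y)) • u x‖ ^ 2 =
      Fintype.card F * ∑ x, ‖u x‖ ^ 2 - ‖∑ x, u x‖ ^ 2 := by
  classical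
  apply Complex.ofReal_injective
  push_cast
  have hn : ∀ e : E, (‖e‖ : ℂ) ^ 2 = inner ℂ e e := fun e => (inner_self_eq_norm_sq_to_K e).symm
  simp only [hn, sum_inner, inner_sum, inner_smul_left, inner_smul_right]
  calc _ = ∑ x, ∑ x', (∑ y, χ (x' + y) * star (χ (x + y))) * inner ℂ (u x') (u x) := by
        rw [Finset.sum_comm]
        refine Finset.sum_congr rfl fun x _ => ?_
        simp_rw [Finset.mul_sum]
        rw [Finset.sum_comm]
        refine Finset.sum_congr rfl fun x' _ => ?_
        rw [Finset.sum_mul]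
        refine Finset.sum_congr rfl fun y _ => ?_
        simp only [starRingEnd_apply, star_star]
        ring
    _ = _ := by
        simp only [sum_mulChar_add_mul_star hχ, sub_mul, one_mul, ite_mul, zero_mul,
          Finset.sum_sub_distrib, Finset.sum_ite_eq', Finset.mem_univ, if_true, Finset.mul_sum]

/-- Cauchy–Schwarz in `E` removes `v`; Cauchy–Schwarz over `y` then reduces to the preceding
identity, whose negative term is dropped. -/
theorem norm_sum_star_mulChar_mul_inner_le {χ : MulChar F ℂ} (hχ : χ ≠ 1) {u v : F → E}
    (hu : ∀ x, ‖u x‖ ≤ 1) (hv : ∀ y, ‖v y‖ ≤ 1) :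
    ‖∑ y, ∑ x, star (χ (x + y)) * inner ℂ (v y) (u x)‖ ≤
      Fintype.card F * √(Fintype.card F) := by
  have h1 : ∑ y, ∑ x, star (χ (x + y)) * inner ℂ (v y) (u x) =
      ∑ y, inner ℂ (v y) (∑ x, star (χ (x + y)) • u x) := by
    simp only [inner_sum, inner_smul_right]
  set q : ℝ := (Fintype.card F : ℝ) with hq
  have hq0 : 0 ≤ q := Nat.cast_nonneg _
  have h2 : (∑ y, ‖∑ x, star (χ (x + y)) • u x‖) ^ 2 ≤ q * (q * q) := by
    refine (sq_sum_le_card_mul_sum_sq (s := Finset.univ)).trans ?_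
    rw [Finset.card_univ, sum_norm_sq_sum_star_mulChar_smul hχ]
    refine mul_le_mul_of_nonneg_left ?_ hq0
    refine (sub_le_self _ (sq_nonneg _)).trans (mul_le_mul_of_nonneg_left ?_ hq0)
    refine (Finset.sum_le_card_nsmul _ _ 1 fun x _ => pow_le_one₀ (norm_nonneg _) (hu x)).trans ?_
    simp [hq]
  rw [h1]
  calc _ ≤ ∑ y, ‖∑ x, star (χ (x + y)) • u x‖ := by
        refine (norm_sum_le _ _).trans (Finset.sum_le_sum fun y _ => ?_)
        exact (norm_inner_le_norm _ _).trans (mul_le_of_le_one_left (norm_nonneg _) (hv y))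
    _ ≤ q * √q := by
        refine abs_le_of_sq_le_sq' ?_ (by positivity) |>.2
        rw [mul_pow, Real.sq_sqrt hq0]
        linarith

end Characters
end QComm

namespace QComm

/-! ### Correlation of a correct protocol with the character -/

section LowerBound

/-- A random value that equals a fixed point of the unit circle with probability at least `2/3` has
a mean that correlates with this point. -/
theorem one_third_le_re_star_mul_sum {S : Finset ℂ} {p : ℂ → ℝ} {z₀ : ℂ}
    (hS : ∀ z ∈ S, ‖z‖ ≤ 1) (hp : ∀ z, 0 ≤ p z) (hsum : ∑ z ∈ S, p z ≤ 1) (hz₀ : z₀ ∈ S)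
    (hn : ‖z₀‖ = 1) (h : 2 / 3 ≤ p z₀) :
    1 / 3 ≤ (star z₀ * ∑ z ∈ S, z * (p z : ℂ)).re := by
  classical
  rw [Finset.mul_sum, Complex.re_sum, ← Finset.add_sum_erase S _ hz₀]
  rw [← Finset.add_sum_erase S _ hz₀] at hsum
  have h1 : (star z₀ * (z₀ * (p z₀ : ℂ))).re = p z₀ := by
    rw [← mul_assoc, ← starRingEnd_apply, Complex.conj_mul', hn]
    simp
  have h2 : -∑ z ∈ S.erase z₀, p z ≤ ∑ z ∈ S.erase z₀, (star z₀ * (z * (p z : ℂ))).re := by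
    rw [← Finset.sum_neg_distrib]
    refine Finset.sum_le_sum fun z hz => ?_
    refine (abs_le.1 ((Complex.abs_re_le_norm _).trans ?_)).1
    rw [norm_mul, norm_mul, norm_star, hn, one_mul, Complex.norm_real, Real.norm_of_nonneg (hp z)]
    exact mul_le_of_le_one_left (hp z) (hS z (Finset.mem_of_mem_erase hz))
  linarith

variable {F : Type*} [Field F]

theorem norm_mulChar_eq_one [Fintype F] (χ : MulChar F ℂ) {a : F} (ha : a ≠ 0) : ‖χ a‖ = 1 := by
  have h0 : Fintype.card F - 1 ≠ 0 := Nat.sub_ne_zero_of_lt Fintype.one_lt_card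
  refine Complex.norm_eq_one_of_pow_eq_one (n := Fintype.card F - 1) ?_ h0
  rw [← map_pow, FiniteField.pow_card_sub_one_eq_one a ha, map_one]

theorem norm_mulChar_le_one [Fintype F] (χ : MulChar F ℂ) (a : F) : ‖χ a‖ ≤ 1 := by
  by_cases ha : a = 0
  · simp [ha, MulChar.map_zero]
  · exact (norm_mulChar_eq_one χ ha).le

theorem card_sub_one_le_of_isComputableWith [Fintype F] {χ : MulChar F ℂ} (hχ : χ ≠ 1) {n : ℕ}
    (h : IsComputableWith (1 / 3) (fun x y : F => χ (x + y)) n) :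
    (Fintype.card F : ℝ) - 1 ≤ 3 * (4 ^ n * √(Fintype.card F)) := by
  classical
  obtain ⟨a, b, φ, P, hφ, rfl, hP⟩ := h
  set q : ℝ := (Fintype.card F : ℝ) with hq
  have hq0 : 0 < q := Nat.cast_pos.2 Fintype.card_pos
  set S : Finset ℂ := Finset.univ.image χ with hS
  have hS1 : ∀ z ∈ S, ‖z‖ ≤ 1 := by
    intro z hz
    obtain ⟨a, -, rfl⟩ := Finset.mem_image.1 hz
    exact norm_mulChar_le_one χ a
  set T : ℂ := ∑ y, ∑ x, star (χ (x + y)) * ∑ z ∈ S, z * (P.outputProb x y z φ : ℂ) with hT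
  have lower : q * (q - 1) / 3 ≤ T.re := by
    have hy : ∀ y : F, (q - 1) / 3 ≤
        ∑ x, (star (χ (x + y)) * ∑ z ∈ S, z * (P.outputProb x y z φ : ℂ)).re := by
      intro y
      -- At `x = -y` the target is 0 and contributes nothing; each other `x` contributes at least
      -- `1/3`.
      have hs : (q - 1) / 3 = ∑ x : F, ((1 : ℝ) / 3 - if x = -y then 1 / 3 else 0) := by
        rw [Finset.sum_sub_distrib, Finset.sum_ite_eq', if_pos (Finset.mem_univ _)]
        simp [hq]
        ring
      rw [hs]
      refine Finset.sum_le_sum fun x _ => ?_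
      split_ifs with hx
      · simp [hx, MulChar.map_zero]
      · rw [sub_zero]
        have hxy : x + y ≠ 0 := fun h0 => hx (eq_neg_of_add_eq_zero_left h0)
        refine one_third_le_re_star_mul_sum hS1 (fun z => P.outputProb_nonneg x y z φ)
          ((P.sum_outputProb_le S x y φ).trans_eq hφ)
          (Finset.mem_image_of_mem _ (Finset.mem_univ _)) (norm_mulChar_eq_one χ hxy) ?_
        have := hP x y
        norm_num at this ⊢
        exact this
    rw [hT, Complex.re_sum]
    simp_rw [Complex.re_sum]
    have := Finset.card_nsmul_le_sum Finset.univ _ _ fun y _ => hy y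
    rw [Finset.card_univ, nsmul_eq_mul] at this
    linarith
  have upper : ‖T‖ ≤ 4 ^ P.cost * (q * √q) := by
    obtain ⟨ι, _, M, N, hι, hM, hN, hE⟩ :=
      hasContractionForm_sum_mul_outputProb (w := fun z => z) S hS1 P
    have hT' : T = ∑ s : ι, ∑ y : F, ∑ x : F,
        star (χ (x + y)) * (M s x * φ * N s y * φ.conjTranspose).trace := by
      rw [hT, Finset.sum_comm (s := Finset.univ (α := ι))]
      refine Finset.sum_congr rfl fun y _ => ?_
      rw [Finset.sum_comm (s := Finset.univ (α := ι))]
      refine Finset.sum_congr rfl fun x _ => ?_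
      rw [← Finset.mul_sum, ← hE x y φ]
    rw [hT']
    refine (norm_sum_le_of_le _ (n := fun _ => q * √q) fun s _ => ?_).trans_eq ?_
    · obtain ⟨u, v, hu, hv, huv⟩ := exists_trace_eq_inner hφ (hM s) (hN s)
      simp_rw [huv]
      exact norm_sum_star_mulChar_mul_inner_le hχ hu hv
    · rw [Finset.sum_const, Finset.card_univ, hι, nsmul_eq_mul]
      push_cast
      rfl
  have := (lower.trans (Complex.re_le_norm T)).trans upper
  refine le_of_mul_le_mul_left ?_ hq0
  linarith

/-- With no message, Bob on `y = 0` would output both `χ 0 = 0` and `χ 1 = 1` with probability at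
least `2/3`. Excluding `n = 0` lets constants be absorbed into powers of `4 ^ n`. -/
theorem ne_zero_of_isComputableWith (χ : MulChar F ℂ) {n : ℕ}
    (h : IsComputableWith (1 / 3) (fun x y : F => χ (x + y)) n) : n ≠ 0 := by
  classical
  rintro rfl
  obtain ⟨a, b, φ, P, hφ, hn, hP⟩ := h
  have h0 := hP 0 0
  have h1 := hP 1 0
  rw [P.outputProb_eq_of_cost_eq_zero hn 1 0] at h1
  have h2 := (P.sum_outputProb_le {0, 1} 0 0 φ).trans_eq hφ
  rw [Finset.sum_pair zero_ne_one] at h2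
  simp only [add_zero, MulChar.map_zero, map_one] at h0 h1
  linarith

theorem log_card_le_of_isComputableWith [Fintype F] {χ : MulChar F ℂ} (hχ : χ ≠ 1) {n : ℕ}
    (h : IsComputableWith (1 / 3) (fun x y : F => χ (x + y)) n) :
    Real.log (Fintype.card F) ≤ 12 * Real.log 2 * n := by
  have h1 := card_sub_one_le_of_isComputableWith hχ h
  have hn : 1 ≤ n := Nat.one_le_iff_ne_zero.2 (ne_zero_of_isComputableWith χ h)
  set q : ℝ := (Fintype.card F : ℝ) with hq
  have hq2 : 2 ≤ q := Nat.ofNat_le_cast.2 (Fintype.one_lt_card (α := F))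
  have hs : 0 < √q := Real.sqrt_pos.2 (by linarith)
  have hss : √q * √q = q := Real.mul_self_sqrt (by linarith)
  -- From `q ≤ 2 * (q - 1)`, valid for `q ≥ 2`.
  have h2 : √q ≤ 6 * 4 ^ n := by
    refine le_of_mul_le_mul_right ?_ hs
    linarith
  have h3 : (6 : ℝ) ≤ (4 ^ n) ^ 2 := by
    have : (4 : ℝ) ^ 1 ≤ 4 ^ n := pow_le_pow_right₀ (by norm_num) hn
    nlinarith
  have h4 : √q ≤ 2 ^ (6 * n) := by
    calc √q ≤ (4 ^ n) ^ 2 * 4 ^ n := h2.trans (by gcongr)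
      _ = 2 ^ (6 * n) := by
        rw [← pow_succ, ← pow_mul, show (4 : ℝ) = 2 ^ 2 by norm_num, ← pow_mul]
        congr 1
        ring
  have h5 := Real.log_le_log hs h4
  rw [Real.log_sqrt (by linarith), Real.log_pow] at h5
  push_cast at h5
  linarith

/-- The multiplicative character with the values of a multiplicative function that is nontrivial on
the nonzero elements. -/
theorem exists_mulChar_eq {χ : F → ℂ} (hmul : ∀ x y, χ (x * y) = χ x * χ y)
    (hne : ¬ ∀ x, x ≠ 0 → χ x = 1) {a : F} (ha : χ a = 1) :
    ∃ ψ : MulChar F ℂ, ψ ≠ 1 ∧ ⇑ψ = χ := by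
  push Not at hne
  obtain ⟨x, hx0, hx⟩ := hne
  have h1 : χ 1 = 1 := by rw [← mul_one (χ 1), ← ha, ← hmul, one_mul]
  -- Otherwise cancelling `χ 0` in `χ 0 * χ x = χ 0` would give `χ x = 1`.
  have h0 : χ 0 = 0 := by
    by_contra h
    refine hx (mul_left_cancel₀ h ?_)
    rw [← hmul, zero_mul, mul_one]
  refine ⟨⟨⟨⟨χ, h1⟩, hmul⟩, fun a ha => ?_⟩, fun h => hx ?_, rfl⟩
  · rw [isUnit_iff_ne_zero, not_not] at ha
    exact ha ▸ h0
  · have := congrArg (fun ψ : MulChar F ℂ => ψ x) h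
    rwa [MulChar.one_apply (isUnit_iff_ne_zero.2 hx0)] at this

end LowerBound

end QComm

theorem mainTheorem6 :
    ∃ c : ℝ, 0 < c ∧
      ∀ (F : Type*) [Field F] [Fintype F] (χ : F → ℂ),
        (∀ x y : F, χ (x * y) = χ x * χ y) →
        (¬ ∀ x : F, x ≠ 0 → χ x = 1) →
        ∀ g : Fˣ, (∀ u : Fˣ, u ∈ Subgroup.zpowers g) →
        ∀ d : ℕ, 1 ≤ d → χ ((g : F) ^ d) = 1 →
          c * (Real.log (Fintype.card F) / Real.log (d + 1)) ≤
            (QComm.Qcc (fun x y : F => χ (x + y)) : ℝ) := by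
  refine ⟨1 / 12, by norm_num, fun F _ _ χ hmul hne g _ d hd hχ => ?_⟩
  obtain ⟨ψ, hψ, rfl⟩ := QComm.exists_mulChar_eq hmul hne hχ
  have hmin : QComm.IsComputableWith (1 / 3) (fun x y : F => ψ (x + y))
      (QComm.Qcc fun x y : F => ψ (x + y)) :=
    Nat.sInf_mem (QComm.exists_isComputableWith (by norm_num) _)
  have hlog := QComm.log_card_le_of_isComputableWith hψ hmin
  have h2 : 0 < Real.log 2 := Real.log_pos one_lt_two
  have hd2 : Real.log 2 ≤ Real.log (d + 1) := by
    refine Real.log_le_log two_pos ?_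
    have : (1 : ℝ) ≤ d := by exact_mod_cast hd
    linarith
  rw [← mul_div_assoc, div_le_iff₀ (h2.trans_le hd2)]
  have := mul_le_mul_of_nonneg_left hd2
    (Nat.cast_nonneg (α := ℝ) (QComm.Qcc fun x y : F => ψ (x + y)))
  linarith
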